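/- A real $N\times N$ matrix $B$ with nonnegative entries is called *infinitely divisible* if for every integer $n\ge 1$ there is an entrywise nonnegative matrix $K_n$ with $(K_n)^n=B$; it is called *strongly infinitely divisible* if in addition $\det B>0$. A nonnegative matrix is *irreducible* if its directed graph (with an edge $i\to j$ whenever the $(i,j)$ entry is positive) is strongly connected, where the $1\times 1$ zero matrix is not irreducible, and *reducible* otherwise. **Theorem.** Let $B$ be a strongly infinitely divisible nonnegative matrix. Then: 1. If $B$ is irreducible, then all entries of $B$ are strictly positive. 2. If $B$ is reducible, then there exist a permutation matrix $L$ and an infinitely divisible matrix $U$ with $B=LUL^{T}$ such that $U$ is block upper triangular with respect to a partition of the indices into $M\ge 2$ nonempty blocks of consecutive indices, and moreover: (a) all the diagonal blocks of $U$ have strictly positive entries; (b) for every integer $0\le n\le M$ the square submatrix $U^{(n)}$, obtained from $U$ by deleting the first $n$ blocks of rows and the first $n$ blocks of columns, is strongly infinitely divisible (for $n=M$ this is the empty matrix, with determinant $1$, and the claim is void). -/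

import Mathlib

/-- Entrywise nonnegative real matrix. -/
def Matrix.EntrywiseNonneg {ι : Type*} (B : Matrix ι ι ℝ) : Prop :=
  ∀ i j, 0 ≤ B i j

/-- Entrywise strictly positive real matrix. -/
def Matrix.StrictlyPositive {ι : Type*} (B : Matrix ι ι ℝ) : Prop :=
  ∀ i j, 0 < B i j

/-- A nonnegative matrix `B` is infinitely divisible if it has an entrywise nonnegative `n`-th root
`K n` for every `n ≥ 1` (the value `K 0` plays no role). -/
def Matrix.InfinitelyDivisible {ι : Type*} [Fintype ι] [DecidableEq ι]
    (B : Matrix ι ι ℝ) : Prop :=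
  B.EntrywiseNonneg ∧
    ∃ K : ℕ → Matrix ι ι ℝ, ∀ n : ℕ, 1 ≤ n → (K n).EntrywiseNonneg ∧ (K n) ^ n = B

/-- An infinitely divisible matrix with positive determinant. -/
def Matrix.StronglyInfinitelyDivisible {ι : Type*} [Fintype ι] [DecidableEq ι]
    (B : Matrix ι ι ℝ) : Prop :=
  B.InfinitelyDivisible ∧ 0 < B.det

/-- A nonnegative square matrix is reducible if it is not irreducible, i.e. if its directed graph
(an edge `i → j` whenever the `(i, j)` entry is positive) is not strongly connected.
The `1 × 1` zero matrix counts as reducible. -/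
def Matrix.Reducible {ι : Type*} (B : Matrix ι ι ℝ) : Prop :=
  B.EntrywiseNonneg ∧ ¬ B.IsIrreducible

/-- `b` describes a partition of the indices `0, …, N - 1` into `M` nonempty blocks of consecutive
indices, numbered from left to right: index `i` lies in the block number `b i`. -/
def IsBlockPartition {N M : ℕ} (b : Fin N → Fin M) : Prop :=
  Monotone b ∧ Function.Surjective b

/-- The diagonal block of `U` number `k`, for the partition `b`. -/
def Matrix.diagBlock {N M : ℕ} (U : Matrix (Fin N) (Fin N) ℝ) (b : Fin N → Fin M) (k : Fin M) :
    Matrix {i : Fin N // b i = k} {i : Fin N // b i = k} ℝ :=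
  U.submatrix Subtype.val Subtype.val

/-- The trailing principal submatrix obtained from `U` by deleting the rows and columns of the
first `n` blocks of the partition `b` (the blocks number `0, …, n - 1`). -/
def Matrix.trailingBlocks {N M : ℕ} (U : Matrix (Fin N) (Fin N) ℝ) (b : Fin N → Fin M) (n : ℕ) :
    Matrix {i : Fin N // n ≤ (b i : ℕ)} {i : Fin N // n ≤ (b i : ℕ)} ℝ :=
  U.submatrix Subtype.val Subtype.val

/-! For nonnegative `A`, the support of `A ^ (m + 1)` depends only on that of `A ^ m`, so the
supports are eventually periodic. Hence some exponent `e`, depending only on the index set, gives `A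
^ e` and `A ^ (2 * e)` the same support, which is then transitive. Since `B` has an `(e * n)`-th
root, the `e`-th power of that root is an `n`-th root of `B` with transitive support. Invertibility
makes the support reflexive as well, so it lies inside the support of `B`; for `n = 1` the support
of `B` itself is a preorder. If `B` is irreducible, this preorder has a single class. Otherwise,
listing the classes along a linear extension gives the block form, and restricting these roots to an
upward closed set of indices gives roots of the trailing blocks. -/

/-- A sequence in a finite type in which each term determines the next one
satisfies `f n = f (2 * n)` for `n` the factorial of the cardinality. -/
theorem eq_two_mul_factorial_of_step {α : Type*} [Fintype α] (f : ℕ → α)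
    (hf : ∀ m n, f m = f n → f (m + 1) = f (n + 1)) :
    f (Fintype.card α).factorial = f (2 * (Fintype.card α).factorial) := by
  obtain ⟨a, b, hab, hfab⟩ : ∃ a b : Fin (Fintype.card α + 1), a < b ∧ f a = f b := by
    obtain ⟨x, y, hxy, h⟩ := Fintype.exists_ne_map_eq_of_card_lt
      (fun i : Fin (Fintype.card α + 1) => f i) (by simp)
    rcases lt_or_gt_of_ne hxy with h' | h'
    · exact ⟨x, y, h', h⟩
    · exact ⟨y, x, h', h.symm⟩
  have hlt : (a : ℕ) < b := hab
  have hb : (b : ℕ) ≤ Fintype.card α := Nat.lt_succ_iff.mp b.2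
  have shift : ∀ k, f (a + k) = f (b + k) := by
    intro k
    induction k with
    | zero => exact hfab
    | succ k ih => exact hf _ _ ih
  have period : ∀ m, (a : ℕ) ≤ m → ∀ t, f m = f (m + (b - a) * t) := by
    intro m hm t
    induction t with
    | zero => simp
    | succ t ih =>
      rw [ih]
      have h := shift (m + (b - a) * t - a)
      rw [show (a : ℕ) + (m + (b - a) * t - a) = m + (b - a) * t by omega] at h
      rw [h, mul_add, mul_one]
      congr 1
      omega
  -- The factorial is a multiple of the period `b - a` and is at least the preperiod `a`.
  obtain ⟨t, ht⟩ : ((b : ℕ) - a) ∣ (Fintype.card α).factorial :=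
    Nat.dvd_factorial (by omega) (by omega)
  have := period (Fintype.card α).factorial
    (by have := Nat.self_le_factorial (Fintype.card α); omega) t
  rwa [← ht, ← two_mul] at this

namespace Matrix

variable {ι : Type*} [Fintype ι]

theorem EntrywiseNonneg.mul_apply_pos_iff {A B : Matrix ι ι ℝ} (hA : A.EntrywiseNonneg)
    (hB : B.EntrywiseNonneg) (i j : ι) :
    0 < (A * B) i j ↔ ∃ k, 0 < A i k ∧ 0 < B k j := by
  rw [mul_apply, Finset.sum_pos_iff_of_nonneg fun k _ => mul_nonneg (hA i k) (hB k j)]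
  refine exists_congr fun k => ?_
  simp only [Finset.mem_univ, true_and]
  refine ⟨fun h => ?_, fun h => mul_pos h.1 h.2⟩
  exact ⟨pos_of_mul_pos_left h (hB k j), pos_of_mul_pos_right h (hA i k)⟩

/-- The exponent that makes the support of every nonnegative matrix transitive. -/
noncomputable def supportExponent (ι : Type*) : ℕ := (Nat.card (Set (ι × ι))).factorial

theorem supportExponent_pos (ι : Type*) : 0 < supportExponent ι := Nat.factorial_pos _

variable [DecidableEq ι]

theorem EntrywiseNonneg.pow {A : Matrix ι ι ℝ} (hA : A.EntrywiseNonneg) (n : ℕ) :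
    (A ^ n).EntrywiseNonneg :=
  pow_apply_nonneg hA n

theorem EntrywiseNonneg.pow_supportExponent_trans {A : Matrix ι ι ℝ} (hA : A.EntrywiseNonneg)
    {i j k : ι} (hij : 0 < (A ^ supportExponent ι) i j) (hjk : 0 < (A ^ supportExponent ι) j k) :
    0 < (A ^ supportExponent ι) i k := by
  classical
  have h := eq_two_mul_factorial_of_step
    (fun n => {p : ι × ι | 0 < (A ^ n) p.1 p.2}) (fun m n hmn => by
      ext p
      simp only [Set.mem_ofPred_eq, pow_succ, (hA.pow _).mul_apply_pos_iff hA]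
      refine exists_congr fun k => and_congr_left fun _ => ?_
      exact Set.ext_iff.mp hmn (p.1, k))
  rw [← Nat.card_eq_fintype_card] at h
  refine (Set.ext_iff.mp h (i, k)).mpr ?_
  change 0 < (A ^ (2 * supportExponent ι)) i k
  rw [two_mul, pow_add, (hA.pow _).mul_apply_pos_iff (hA.pow _)]
  exact ⟨j, hij, hjk⟩

/-- A nonzero determinant has a nonzero Leibniz term, hence a permutation supported in `A`;
transitivity around its cycles yields loops at every index. -/
theorem EntrywiseNonneg.diag_pos_of_trans {A : Matrix ι ι ℝ} (hA : A.EntrywiseNonneg)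
    (hdet : A.det ≠ 0) (htrans : ∀ i j k, 0 < A i j → 0 < A j k → 0 < A i k) (i : ι) :
    0 < A i i := by
  obtain ⟨σ, hσ⟩ : ∃ σ : Equiv.Perm ι, ∀ i, 0 < A (σ i) i := by
    by_contra! hcon
    refine hdet ?_
    rw [det_apply]
    refine Finset.sum_eq_zero fun σ _ => ?_
    obtain ⟨i, hi⟩ := hcon σ
    have h0 : ∏ j, A (σ j) j = 0 := Finset.prod_eq_zero (Finset.mem_univ i) (le_antisymm hi (hA _ _))
    rw [h0, smul_zero]
  have hpow : ∀ n : ℕ, 0 < A ((σ ^ (n + 1)) i) i := by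
    intro n
    induction n with
    | zero => simpa using hσ i
    | succ n ih =>
      refine htrans _ _ _ ?_ ih
      rw [pow_succ' σ (n + 1)]
      exact hσ _
  have := hpow (orderOf σ - 1)
  rwa [Nat.sub_add_cancel (orderOf_pos σ), pow_orderOf_eq_one, Equiv.Perm.one_apply] at this

/-- The positive entries of an invertible infinitely divisible matrix form a preorder, and its
roots can be chosen with support in that of the matrix. -/
theorem InfinitelyDivisible.exists_roots {B : Matrix ι ι ℝ} (hB : B.InfinitelyDivisible)
    (hdet : B.det ≠ 0) :
    (∀ i, 0 < B i i) ∧ (∀ i j k, 0 < B i j → 0 < B j k → 0 < B i k) ∧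
      ∃ K : ℕ → Matrix ι ι ℝ, ∀ n, 1 ≤ n → (K n).EntrywiseNonneg ∧ K n ^ n = B ∧
        ∀ i j, B i j = 0 → K n i j = 0 := by
  obtain ⟨H, hH⟩ := hB.2
  -- The exponent does not depend on the matrix, so it serves the roots of all orders at once.
  set e := supportExponent ι with he
  have hroot : ∀ n, 1 ≤ n → (H (e * n)).EntrywiseNonneg ∧ (H (e * n) ^ e) ^ n = B := by
    intro n hn
    have h := hH (e * n) (Nat.mul_pos (supportExponent_pos ι) hn)
    exact ⟨h.1, by rw [← pow_mul, h.2]⟩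
  have htrans : ∀ n, 1 ≤ n → ∀ i j k, 0 < (H (e * n) ^ e) i j → 0 < (H (e * n) ^ e) j k →
      0 < (H (e * n) ^ e) i k := fun n hn i j k =>
    (hroot n hn).1.pow_supportExponent_trans
  have hdiag : ∀ n, 1 ≤ n → ∀ i, 0 < (H (e * n) ^ e) i i := by
    intro n hn
    refine ((hroot n hn).1.pow e).diag_pos_of_trans (fun h0 => hdet ?_) (htrans n hn)
    rw [← (hroot n hn).2, det_pow, h0, zero_pow (by omega)]
  have hone : H (e * 1) ^ e = B := by simpa using (hroot 1 le_rfl).2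
  refine ⟨hone ▸ hdiag 1 le_rfl, hone ▸ htrans 1 le_rfl, fun n => H (e * n) ^ e,
    fun n hn => ⟨(hroot n hn).1.pow e, (hroot n hn).2, fun i j hij => ?_⟩⟩
  by_contra hne
  have hK := (hroot n hn).1.pow e
  have hpos : 0 < (H (e * n) ^ e) i j := lt_of_le_of_ne (hK i j) (Ne.symm hne)
  -- The edge from `i` to `j` is prolonged to a walk of any length by the loop at `i`.
  have hpow : ∀ m : ℕ, 0 < ((H (e * n) ^ e) ^ (m + 1)) i j := by
    intro m
    induction m with
    | zero => simpa using hpos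
    | succ m ih =>
      rw [pow_succ', hK.mul_apply_pos_iff (hK.pow _)]
      exact ⟨i, hdiag n hn i, ih⟩
  have := hpow (n - 1)
  rw [Nat.sub_add_cancel hn, (hroot n hn).2, hij] at this
  exact lt_irrefl _ this

/-- A walk that starts inside `p` never leaves it, so the indices outside contribute nothing. -/
theorem submatrix_val_pow (K : Matrix ι ι ℝ) (p : ι → Prop) [DecidablePred p]
    (hK : ∀ i, p i → ∀ j, ¬p j → K i j = 0) (n : ℕ) :
    (K.submatrix Subtype.val Subtype.val : Matrix {i // p i} {i // p i} ℝ) ^ n =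
      (K ^ n).submatrix Subtype.val Subtype.val := by
  induction n with
  | zero => simp [submatrix_one _ Subtype.val_injective]
  | succ n ih =>
    ext i j
    rw [pow_succ', ih, submatrix_apply, pow_succ', mul_apply, mul_apply,
      ← Fintype.sum_subtype_add_sum_subtype p fun k => K i k * (K ^ n) k j,
      Finset.sum_eq_zero (s := (Finset.univ : Finset {x // ¬p x}))
        fun k _ => by rw [hK i i.2 k k.2, zero_mul], add_zero]
    rfl

theorem StronglyInfinitelyDivisible.submatrix_val {B : Matrix ι ι ℝ}
    (hB : B.StronglyInfinitelyDivisible) (p : ι → Prop) [DecidablePred p]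
    (hp : ∀ i, p i → ∀ j, ¬p j → B i j = 0) :
    (B.submatrix Subtype.val Subtype.val :
      Matrix {i // p i} {i // p i} ℝ).StronglyInfinitelyDivisible := by
  obtain ⟨-, -, K, hK⟩ := hB.1.exists_roots hB.2.ne'
  have hpow : ∀ n, 1 ≤ n → ((K n).submatrix Subtype.val Subtype.val :
      Matrix {i // p i} {i // p i} ℝ) ^ n = B.submatrix Subtype.val Subtype.val := by
    intro n hn
    rw [submatrix_val_pow _ p (fun i hi j hj => (hK n hn).2.2 i j (hp i hi j hj)), (hK n hn).2.1]
  refine ⟨⟨fun i j => hB.1.1 i j, fun n => (K n).submatrix Subtype.val Subtype.val,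
    fun n hn => ⟨fun i j => (hK n hn).1 i j, hpow n hn⟩⟩, ?_⟩
  -- The determinant is a square because there is a square root, and nonzero because it is a factor
  -- of `B.det`.
  refine lt_of_le_of_ne ?_ fun h0 => hB.2.ne' ?_
  · rw [← hpow 2 one_le_two, det_pow]
    exact sq_nonneg _
  · rw [twoBlockTriangular_det' B p hp]
    exact mul_eq_zero_of_left h0.symm _

theorem InfinitelyDivisible.submatrix_perm {B : Matrix ι ι ℝ} (hB : B.InfinitelyDivisible)
    (σ : Equiv.Perm ι) : (B.submatrix σ σ).InfinitelyDivisible := by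
  obtain ⟨K, hK⟩ := hB.2
  refine ⟨fun i j => hB.1 _ _, fun n => (K n).submatrix σ σ, fun n hn =>
    ⟨fun i j => (hK n hn).1 _ _, ?_⟩⟩
  have := map_pow (reindexAlgEquiv ℝ ℝ σ.symm) (K n) n
  simp only [coe_reindexAlgEquiv, reindex_apply, Equiv.symm_symm, (hK n hn).2] at this
  exact this.symm

theorem StronglyInfinitelyDivisible.submatrix_perm {B : Matrix ι ι ℝ}
    (hB : B.StronglyInfinitelyDivisible) (σ : Equiv.Perm ι) :
    (B.submatrix σ σ).StronglyInfinitelyDivisible :=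
  ⟨hB.1.submatrix_perm σ, by rw [det_submatrix_equiv_self]; exact hB.2⟩

end Matrix

/-- A preorder relation on a finite type has a numbering of its classes along a linear
extension. -/
theorem exists_class_numbering {ι : Type*} [Finite ι] (r : ι → ι → Prop) (hrefl : ∀ i, r i i)
    (htrans : ∀ i j k, r i j → r j k → r i k) :
    ∃ (M : ℕ) (c : ι → Fin M), Function.Surjective c ∧ (∀ i j, r i j → c i ≤ c j) ∧
      ∀ i j, c i = c j → r i j := by
  let _ : Preorder ι :=
    { le := r, le_refl := hrefl, le_trans := htrans }
  have : Finite (LinearExtension (Antisymmetrization ι (· ≤ ·))) :=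
    inferInstanceAs (Finite (Quotient (AntisymmRel.setoid ι (· ≤ ·))))
  have := Fintype.ofFinite (LinearExtension (Antisymmetrization ι (· ≤ ·)))
  let e := (Fintype.orderIsoFinOfCardEq
    (LinearExtension (Antisymmetrization ι (· ≤ ·))) rfl).symm
  refine ⟨_, fun i => e (toLinearExtension (toAntisymmetrization (· ≤ ·) i)), ?_, ?_, ?_⟩
  · refine e.surjective.comp (Function.Surjective.comp ?_ (Quotient.mk_surjective))
    exact Function.surjective_id
  · intro i j hij
    exact e.monotone (toLinearExtension.monotone (toAntisymmetrization_mono hij))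
  · intro i j hij
    have h : toAntisymmetrization (· ≤ ·) i = toAntisymmetrization (· ≤ ·) j := e.injective hij
    exact (Quotient.exact h).1

theorem theorem3 {N : ℕ} (B : Matrix (Fin N) (Fin N) ℝ) (hB : B.StronglyInfinitelyDivisible) :
    (B.IsIrreducible → B.StrictlyPositive) ∧
    (B.Reducible →
      ∃ (L : Equiv.Perm (Fin N)) (U : Matrix (Fin N) (Fin N) ℝ) (M : ℕ) (b : Fin N → Fin M),
        B = L.permMatrix ℝ * U * (L.permMatrix ℝ).transpose ∧
        U.InfinitelyDivisible ∧
        2 ≤ M ∧ IsBlockPartition b ∧ U.BlockTriangular b ∧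
        (∀ k : Fin M, (U.diagBlock b k).StrictlyPositive) ∧
        (∀ n : ℕ, n ≤ M → (U.trailingBlocks b n).StronglyInfinitelyDivisible)) := by
  obtain ⟨hrefl, htrans, -⟩ := hB.1.exists_roots hB.2.ne'
  have hnn := hB.1.1
  constructor
  · intro hirr i j
    obtain ⟨k, -, hk⟩ := (Matrix.isIrreducible_iff_exists_pow_pos hnn).mp hirr i j
    have hpow : ∀ (k : ℕ) (j : Fin N), 0 < (B ^ k) i j → 0 < B i j := by
      intro k
      induction k with
      | zero =>
        intro j hj
        rcases eq_or_ne i j with rfl | hne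
        · exact hrefl i
        · simp [Matrix.one_apply_ne hne] at hj
      | succ k ih =>
        intro j hj
        rw [pow_succ, (hnn.pow k).mul_apply_pos_iff hnn] at hj
        obtain ⟨l, hl, hlj⟩ := hj
        exact htrans _ _ _ (ih l hl) hlj
    exact hpow k j hk
  · rintro ⟨-, hred⟩
    obtain ⟨M, c, hsurj, hmono, hclass⟩ :=
      exists_class_numbering (fun i j => 0 < B i j) hrefl htrans
    let σ := Tuple.sort c
    have htri : (B.submatrix σ σ).BlockTriangular (c ∘ σ) := by
      intro i j hij
      by_contra hne
      exact absurd (hmono _ _ (lt_of_le_of_ne (hnn (σ i) (σ j)) (Ne.symm hne))) (not_le.mpr hij)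
    -- Conjugating by the permutation matrix of `σ⁻¹` undoes the reindexing by `σ`.
    refine ⟨σ⁻¹, B.submatrix σ σ, M, c ∘ σ, ?_, hB.1.submatrix_perm σ, ?_,
      ⟨Tuple.monotone_sort c, hsurj.comp σ.surjective⟩, htri, ?_, ?_⟩
    · rw [Matrix.transpose_permMatrix, Equiv.Perm.permMatrix, Equiv.Perm.permMatrix,
        PEquiv.toMatrix_toPEquiv_mul, PEquiv.mul_toMatrix_toPEquiv]
      ext i j
      simp [← Equiv.Perm.inv_def]
    -- With fewer than two classes all indices are equivalent, so `B` would be strictly positive,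
    -- hence irreducible.
    · by_contra! hM
      refine hred ((Matrix.isIrreducible_iff_exists_pow_pos hnn).mpr fun i j =>
        ⟨1, one_pos, ?_⟩)
      rw [pow_one]
      exact hclass i j (Fin.ext (by omega))
    · intro k i j
      exact hclass _ _ (i.2.trans j.2.symm)
    · intro n _
      refine (hB.submatrix_perm σ).submatrix_val _ fun i hi j hj => htri ?_
      exact Fin.lt_def.mpr ((not_le.mp hj).trans_le hi)
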